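/- Let $n\in\mathbb N$, let $J=\begin{pmatrix}0&\mathbb 1_n\\-\mathbb 1_n&0\end{pmatrix}\in\mathbb R^{2n\times 2n}$, and let $Sp(2n)=\{S\in\mathbb R^{2n\times 2n} : S^TJS=J\}$. Matrix inequalities are understood in the positive semidefinite order on Hermitian matrices. A covariance matrix is a matrix $\Gamma\in\mathbb R^{2n\times 2n}$ with $\Gamma\ge iJ$, i.e. such that $\Gamma-iJ$ is Hermitian and positive semidefinite; in particular $\Gamma$ is symmetric. For $S\in\mathbb R^{2n\times 2n}$ with singular values $s_1(S)\ge s_2(S)\ge\dots\ge s_{2n}(S)$ put $F(S)=\sum_{i=1}^n\log s_i(S)$, and for a covariance matrix $\Gamma$ define $$G(\Gamma)=\inf\{F(S) : S\in Sp(2n),\ S^TS\le\Gamma\}.$$ Then, for every covariance matrix $\Gamma$, the infimum is taken over a nonempty set that is bounded below, so that $G$ is a well-defined real-valued function on the set of covariance matrices, and: 1. $G$ is lower semicontinuous on the set of covariance matrices $\{\Gamma\in\mathbb R^{2n\times 2n} : \Gamma\ge iJ\}$. 2. $G$ is continuous on the interior of this set, where the interior is taken in the space of real symmetric $2n\times 2n$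 matrices. 3. For every covariance matrix $\Gamma$, $G(\Gamma+\varepsilon\mathbb 1)\to G(\Gamma)$ as $\varepsilon\downarrow 0$. -/

import Mathlib

open scoped Matrix Topology ComplexOrder

noncomputable section

/-- Real `2n × 2n` matrices, in the block ordering `(Q₁, …, Qₙ, P₁, …, Pₙ)` of the canonical
variables. -/
abbrev PhaseMatrix (n : ℕ) : Type := Matrix (Fin n ⊕ Fin n) (Fin n ⊕ Fin n) ℝ

/-- The standard symplectic form `J = [[0, 1], [-1, 0]]`. (Mathlib's `Matrix.J` is its negative.) -/
def sympForm (n : ℕ) : PhaseMatrix n := Matrix.fromBlocks 0 1 (-1) 0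

/-- Mathlib's symplectic group is the group `Sp(2n)` of all real `S` with `Sᵀ J S = J`. -/
theorem mem_symplecticGroup_iff_sympForm (n : ℕ) (S : PhaseMatrix n) :
    S ∈ Matrix.symplecticGroup (Fin n) ℝ ↔ Sᵀ * sympForm n * S = sympForm n := by
  have h : sympForm n = -Matrix.J (Fin n) ℝ := by
    simp [sympForm, Matrix.J, Matrix.fromBlocks_neg]
  rw [h, ← SymplecticGroup.transpose_mem_iff, SymplecticGroup.mem_iff]
  simp

/-- The set of covariance matrices of `n`-mode states: all real `Γ` with `Γ ≥ iJ`, that is, such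
that the complex matrix `Γ - iJ` is Hermitian and positive semidefinite. Such `Γ` are symmetric. -/
def covarianceMatrices (n : ℕ) : Set (PhaseMatrix n) :=
  {Γ | (Γ.map (fun x : ℝ => (x : ℂ)) -
    Complex.I • (sympForm n).map (fun x : ℝ => (x : ℂ))).PosSemidef}

/-- `F(A) = ∑_{i=1}^n log s_i(A)`, with `s_1(A) ≥ s_2(A) ≥ … ≥ s_{2n}(A)` the singular values of
`A` (Mathlib's `singularValues` is the decreasing sequence, indexed from `0`). -/
def squeezingF {n : ℕ} (A : PhaseMatrix n) : ℝ :=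
  ∑ i ∈ Finset.range n, Real.log ((Matrix.toEuclideanLin A).singularValues i)

/-- The costs `F(S)` of all symplectic `S` with `SᵀS ≤ Γ`. -/
def squeezingCosts {n : ℕ} (Γ : PhaseMatrix n) : Set ℝ :=
  {c | ∃ S : PhaseMatrix n, S ∈ Matrix.symplecticGroup (Fin n) ℝ ∧
    (Γ - Sᵀ * S).PosSemidef ∧ c = squeezingF S}

/-- The squeezing measure `G(Γ) = inf {F(S) | SᵀS ≤ Γ, S ∈ Sp(2n)}`. -/
def squeezingG {n : ℕ} (Γ : PhaseMatrix n) : ℝ := sInf (squeezingCosts Γ)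

/-- The space of real symmetric `2n × 2n` matrices, with the subspace topology. -/
abbrev SymmPhaseMatrix (n : ℕ) : Type := {Γ : PhaseMatrix n // Γ.IsSymm}

/-- The interior of the set of covariance matrices, taken in the space of real symmetric matrices
(in the space of all real matrices the interior is empty for `n ≥ 1`). -/
def covarianceInterior (n : ℕ) : Set (SymmPhaseMatrix n) :=
  interior {Γ : SymmPhaseMatrix n | (Γ : PhaseMatrix n) ∈ covarianceMatrices n}

end

/-! ### Comparison of singular values through quadratic forms -/

section SingularValues

open Module InnerProductSpace

variable {E F G : Type*}
  [NormedAddCommGroup E] [InnerProductSpace ℝ E] [FiniteDimensional ℝ E]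
  [NormedAddCommGroup F] [InnerProductSpace ℝ F] [FiniteDimensional ℝ F]
  [NormedAddCommGroup G] [InnerProductSpace ℝ G] [FiniteDimensional ℝ G]

/-! Everything rests on Loewner monotonicity of `F`: `AᵀA ≤ c BᵀB` with `A` invertible gives `F(A) ≤
F(B) + (n/2) log c` (`squeezingF_le_add`). Hence `F` is lower semicontinuous at invertible matrices.
The feasible set of `Γ` is nonempty (`exists_symplectic_le`) and compact, so the infimum is
attained.

Lower semicontinuity of `G` follows by passing to the limit along minimizers. With antitonicity of
`G` this gives the limit along `Γ + ε 1`.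

Upper semicontinuity in the interior needs a near-optimal `T` that stays feasible for all nearby
`Γ'`. Mixing the optimal `SᵀS` with a little of `Γ - δ 1` gives a covariance matrix strictly below
`Γ`, and any symplectic `T` with `TᵀT` below that mixture costs little more than `S`. -/

theorem norm_sq_apply_eq_sum_singularValues (T : E →ₗ[ℝ] F) (v : E) :
    ‖T v‖ ^ 2 = ∑ j : Fin (finrank ℝ E), T.singularValues j ^ 2 *
      (T.isSymmetric_adjoint_comp_self.eigenvectorBasis rfl).repr v j ^ 2 := by
  set b := T.isSymmetric_adjoint_comp_self.eigenvectorBasis rfl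
  calc ‖T v‖ ^ 2 = inner ℝ v ((LinearMap.adjoint T ∘ₗ T) v) := by
        rw [← real_inner_self_eq_norm_sq, LinearMap.comp_apply, LinearMap.adjoint_inner_right]
    _ = inner ℝ (b.repr v) (b.repr ((LinearMap.adjoint T ∘ₗ T) v)) :=
        (b.repr.inner_map_map _ _).symm
    _ = _ := by
        rw [PiLp.inner_apply]
        refine Finset.sum_congr rfl fun j _ => ?_
        rw [T.isSymmetric_adjoint_comp_self.eigenvectorBasis_apply_self_apply rfl v j,
          ← T.sq_singularValues_fin rfl j]
        simp [b]
        ring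

omit [FiniteDimensional ℝ E] in
theorem norm_sq_eq_sum_repr {ι : Type*} [Fintype ι] (b : OrthonormalBasis ι ℝ E) (v : E) :
    ‖v‖ ^ 2 = ∑ j, b.repr v j ^ 2 := by
  rw [← b.repr.norm_map, EuclideanSpace.norm_sq_eq]
  simp

/-- Weyl monotonicity for singular values. -/
theorem singularValues_sq_le_of_norm_sq_le (A : E →ₗ[ℝ] F) (B : E →ₗ[ℝ] G) {c : ℝ}
    (hc : 0 ≤ c) (h : ∀ v, ‖A v‖ ^ 2 ≤ c * ‖B v‖ ^ 2) (i : ℕ) :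
    A.singularValues i ^ 2 ≤ c * B.singularValues i ^ 2 := by
  by_cases! hi : finrank ℝ E ≤ i
  · simp [A.singularValues_of_finrank_le hi, B.singularValues_of_finrank_le hi]
  set a := A.isSymmetric_adjoint_comp_self.eigenvectorBasis rfl
  set b := B.isSymmetric_adjoint_comp_self.eigenvectorBasis rfl
  -- Coordinate `i` of `φ` vanishes, so `φ` has a nonzero kernel vector: orthogonal to the top `i`
  -- right singular vectors of `B` and to those of `A` beyond index `i`.
  let φ : E →ₗ[ℝ] (Fin (finrank ℝ E) → ℝ) := LinearMap.pi fun j =>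
    if (j : ℕ) < i then b.toBasis.coord j else if i < (j : ℕ) then a.toBasis.coord j else 0
  have hφ : ¬ Function.Injective φ := by
    rw [LinearMap.injective_iff_surjective_of_finrank_eq_finrank (by simp)]
    intro hs
    obtain ⟨v, hv⟩ := hs 1
    have := congrFun hv ⟨i, hi⟩
    simp [φ] at this
  obtain ⟨v, hv, hv0⟩ : ∃ v, φ v = 0 ∧ v ≠ 0 := by
    by_contra! hcon
    exact hφ ((injective_iff_map_eq_zero φ).2 hcon)
  have hb : ∀ j : Fin (finrank ℝ E), (j : ℕ) < i → b.repr v j = 0 := fun j hj => by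
    simpa [φ, hj] using congrFun hv j
  have ha : ∀ j : Fin (finrank ℝ E), i < (j : ℕ) → a.repr v j = 0 := fun j hj => by
    simpa [φ, hj, hj.le.not_gt] using congrFun hv j
  have h1 : A.singularValues i ^ 2 * ‖v‖ ^ 2 ≤ ‖A v‖ ^ 2 := by
    rw [norm_sq_apply_eq_sum_singularValues, norm_sq_eq_sum_repr a, Finset.mul_sum]
    refine Finset.sum_le_sum fun j _ => ?_
    by_cases! hj : i < (j : ℕ)
    · simp [a, ha j hj]
    · exact mul_le_mul_of_nonneg_right (pow_le_pow_left₀ (A.singularValues_nonneg _)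
        (A.singularValues_antitone hj) 2) (sq_nonneg _)
  have h2 : ‖B v‖ ^ 2 ≤ B.singularValues i ^ 2 * ‖v‖ ^ 2 := by
    rw [norm_sq_apply_eq_sum_singularValues, norm_sq_eq_sum_repr b, Finset.mul_sum]
    refine Finset.sum_le_sum fun j _ => ?_
    by_cases! hj : (j : ℕ) < i
    · simp [b, hb j hj]
    · exact mul_le_mul_of_nonneg_right (pow_le_pow_left₀ (B.singularValues_nonneg _)
        (B.singularValues_antitone hj) 2) (sq_nonneg _)
  have hpos : 0 < ‖v‖ ^ 2 := by positivity
  refine le_of_mul_le_mul_right ?_ hpos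
  calc _ ≤ _ := h1
    _ ≤ _ := h v
    _ ≤ c * (B.singularValues i ^ 2 * ‖v‖ ^ 2) := mul_le_mul_of_nonneg_left h2 hc
    _ = _ := by ring

end SingularValues

/-! ### The Loewner order on real matrices -/

section Loewner

variable {m : Type*} [Fintype m]

theorem posSemidef_real_iff (A : Matrix m m ℝ) :
    A.PosSemidef ↔ A.IsSymm ∧ ∀ x, 0 ≤ x ⬝ᵥ A *ᵥ x := by
  rw [Matrix.posSemidef_iff_dotProduct_mulVec]
  simp [Matrix.IsHermitian, Matrix.IsSymm, Matrix.conjTranspose_eq_transpose_of_trivial]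

theorem dotProduct_transpose_mul_mulVec (A : Matrix m m ℝ) (x y : m → ℝ) :
    x ⬝ᵥ (Aᵀ * A) *ᵥ y = (A *ᵥ x) ⬝ᵥ (A *ᵥ y) := by
  rw [← Matrix.mulVec_mulVec, Matrix.dotProduct_mulVec, Matrix.vecMul_transpose]

theorem isSymm_transpose_mul (A : Matrix m m ℝ) : (Aᵀ * A).IsSymm := by
  simp [Matrix.IsSymm, Matrix.transpose_mul]

/-- A positive definite matrix has a neighbourhood whose symmetric elements are positive
semidefinite. -/
theorem eventually_posSemidef_of_posDef {M : Matrix m m ℝ} (hM : M.PosDef) :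
    ∀ᶠ N in 𝓝 M, N.IsSymm → N.PosSemidef := by
  have hK : IsCompact (Metric.sphere (0 : m → ℝ) 1) := isCompact_sphere _ _
  have key : ∀ᶠ N in 𝓝 M, ∀ x ∈ Metric.sphere (0 : m → ℝ) 1, 0 < x ⬝ᵥ N *ᵥ x := by
    refine hK.eventually_forall_of_forall_eventually fun x hx => ?_
    have hcont : Continuous fun z : Matrix m m ℝ × (m → ℝ) => z.2 ⬝ᵥ z.1 *ᵥ z.2 :=
      continuous_snd.dotProduct (continuous_fst.matrix_mulVec continuous_snd)
    refine hcont.continuousAt.eventually (lt_mem_nhds ?_)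
    have hx0 : x ≠ 0 := by
      rintro rfl
      simp at hx
    simpa using (Matrix.posDef_iff_dotProduct_mulVec.1 hM).2 hx0
  filter_upwards [key] with N hN hs
  refine (posSemidef_real_iff N).2 ⟨hs, fun x => ?_⟩
  rcases eq_or_ne x 0 with rfl | hx
  · simp
  have hn : 0 < ‖x‖ := norm_pos_iff.2 hx
  have := hN (‖x‖⁻¹ • x) (by simp [norm_smul, hn.ne'])
  rw [Matrix.mulVec_smul, smul_dotProduct, dotProduct_smul, smul_eq_mul, smul_eq_mul] at this
  have h2 : 0 < ‖x‖⁻¹ := inv_pos.2 hn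
  exact ((mul_pos_iff_of_pos_left h2).1 ((mul_pos_iff_of_pos_left h2).1 this)).le

theorem isClosed_posSemidef : IsClosed {A : Matrix m m ℝ | A.PosSemidef} := by
  simp only [posSemidef_real_iff, Set.ofPred_and, Set.ofPred_forall]
  refine IsClosed.inter (isClosed_eq continuous_id.matrix_transpose continuous_id) ?_
  exact isClosed_iInter fun x => isClosed_le continuous_const
    (continuous_const.dotProduct (continuous_id.matrix_mulVec continuous_const))

end Loewner

section SympForm

variable (n : ℕ)

theorem sympForm_eq_neg_J : sympForm n = -Matrix.J (Fin n) ℝ := by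
  simp [sympForm, Matrix.J, Matrix.fromBlocks_neg]

theorem sympForm_transpose : (sympForm n)ᵀ = -sympForm n := by
  simp [sympForm_eq_neg_J]

theorem sympForm_mul_self : sympForm n * sympForm n = -1 := by
  simp [sympForm_eq_neg_J, Matrix.J_squared]

end SympForm

/-! ### Covariance matrices as a convex set of positive definite matrices -/

section Squeezing

variable {n : ℕ}

theorem dotProduct_sympForm_mulVec_comm (v w : Fin n ⊕ Fin n → ℝ) :
    w ⬝ᵥ sympForm n *ᵥ v = -(v ⬝ᵥ sympForm n *ᵥ w) := by
  rw [Matrix.dotProduct_mulVec, ← Matrix.mulVec_transpose, sympForm_transpose, dotProduct_comm,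
    Matrix.neg_mulVec, dotProduct_neg]

/-- Expand the Hermitian form at `z = v + iw`; antisymmetry of `J` merges the two cross terms. -/
theorem mem_covarianceMatrices_iff {Γ : PhaseMatrix n} :
    Γ ∈ covarianceMatrices n ↔ Γ.IsSymm ∧
      ∀ v w, 0 ≤ v ⬝ᵥ Γ *ᵥ v + w ⬝ᵥ Γ *ᵥ w + 2 * (v ⬝ᵥ sympForm n *ᵥ w) := by
  set H : Matrix (Fin n ⊕ Fin n) (Fin n ⊕ Fin n) ℂ := Γ.map (fun x : ℝ => (x : ℂ)) -
    Complex.I • (sympForm n).map (fun x : ℝ => (x : ℂ)) with hH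
  have hre : ∀ z : Fin n ⊕ Fin n → ℂ, (star z ⬝ᵥ H *ᵥ z).re =
      (fun i => (z i).re) ⬝ᵥ Γ *ᵥ (fun i => (z i).re) +
      (fun i => (z i).im) ⬝ᵥ Γ *ᵥ (fun i => (z i).im) +
      2 * ((fun i => (z i).re) ⬝ᵥ sympForm n *ᵥ (fun i => (z i).im)) := by
    intro z
    have h2 := dotProduct_sympForm_mulVec_comm (fun i => (z i).re) (fun i => (z i).im)
    rw [two_mul]
    nth_rw 2 [← neg_neg ((fun i => (z i).re) ⬝ᵥ sympForm n *ᵥ (fun i => (z i).im))]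
    rw [← h2]
    simp only [dotProduct, Matrix.mulVec, Finset.mul_sum, Complex.re_sum, ← Finset.sum_neg_distrib,
      ← Finset.sum_add_distrib]
    refine Finset.sum_congr rfl fun i _ => Finset.sum_congr rfl fun j _ => ?_
    simp [hH]
    ring
  have hherm : H.IsHermitian ↔ Γ.IsSymm := by
    have hJ : ∀ i j, sympForm n j i = -sympForm n i j := fun i j => by
      simpa using congrFun (congrFun (sympForm_transpose n) i) j
    rw [Matrix.IsHermitian.ext_iff, Matrix.IsSymm.ext_iff]
    refine forall₂_congr fun i j => ?_
    simp [hH, hJ i j, Complex.ext_iff]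
  show H.PosSemidef ↔ _
  rw [Matrix.posSemidef_iff_dotProduct_mulVec, hherm]
  refine and_congr_right fun hs => ⟨fun h v w => ?_, fun h z => ?_⟩
  · have := (Complex.nonneg_iff.1 (h fun i => ⟨v i, w i⟩)).1
    rwa [hre] at this
  · refine Complex.nonneg_iff.2 ⟨by rw [hre]; exact h _ _, ?_⟩
    exact ((hherm.2 hs).im_star_dotProduct_mulVec_self z).symm

theorem posDef_of_mem_covarianceMatrices {Γ : PhaseMatrix n} (h : Γ ∈ covarianceMatrices n) :
    Γ.PosDef := by
  obtain ⟨hs, hq⟩ := mem_covarianceMatrices_iff.1 h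
  refine Matrix.posDef_iff_dotProduct_mulVec.2
    ⟨by simpa [Matrix.IsHermitian, Matrix.conjTranspose_eq_transpose_of_trivial] using hs.eq, ?_⟩
  intro v hv
  have h0 : 0 ≤ v ⬝ᵥ Γ *ᵥ v := by simpa using hq v 0
  refine lt_of_le_of_ne (by simpa using h0) fun hz => hv ?_
  replace hz : v ⬝ᵥ Γ *ᵥ v = 0 := by simpa using hz.symm
  set w := sympForm n *ᵥ v with hw
  have hJw : v ⬝ᵥ sympForm n *ᵥ w = -(v ⬝ᵥ v) := by
    rw [hw, Matrix.mulVec_mulVec, sympForm_mul_self, Matrix.neg_mulVec, Matrix.one_mulVec,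
      dotProduct_neg]
  have hvv : 0 ≤ v ⬝ᵥ v := by simpa using dotProduct_star_self_nonneg v
  by_contra hv0
  have hpos : 0 < v ⬝ᵥ v := lt_of_le_of_ne hvv fun h' => hv0 (dotProduct_self_eq_zero.1 h'.symm)
  -- If `vᵀΓv = 0`, the form at `(s v, Jv)` is affine in `s` with slope `-2 v·v`; this `s` makes it
  -- negative.
  have := hq (((w ⬝ᵥ Γ *ᵥ w + 1) / (v ⬝ᵥ v)) • v) w
  rw [Matrix.mulVec_smul, smul_dotProduct, dotProduct_smul, hz, smul_dotProduct, hJw] at this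
  simp only [smul_eq_mul, mul_zero, zero_add, mul_neg, div_mul_cancel₀ _ hpos.ne'] at this
  have h3 : 0 ≤ w ⬝ᵥ Γ *ᵥ w := by simpa using hq w 0
  linarith

theorem add_mem_covarianceMatrices {Γ P : PhaseMatrix n} (h : Γ ∈ covarianceMatrices n)
    (hP : P.PosSemidef) : Γ + P ∈ covarianceMatrices n := by
  obtain ⟨hs, hq⟩ := mem_covarianceMatrices_iff.1 h
  obtain ⟨hs', hq'⟩ := (posSemidef_real_iff P).1 hP
  refine mem_covarianceMatrices_iff.2 ⟨hs.add hs', fun v w => ?_⟩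
  simp only [Matrix.add_mulVec, dotProduct_add]
  linarith [hq v w, hq' v, hq' w]

theorem convex_covarianceMatrices : Convex ℝ (covarianceMatrices n) := by
  intro A hA B hB a b ha hb hab
  obtain ⟨hs, hq⟩ := mem_covarianceMatrices_iff.1 hA
  obtain ⟨hs', hq'⟩ := mem_covarianceMatrices_iff.1 hB
  refine mem_covarianceMatrices_iff.2 ⟨(hs.smul a).add (hs'.smul b), fun v w => ?_⟩
  simp only [Matrix.add_mulVec, dotProduct_add, Matrix.smul_mulVec, dotProduct_smul, smul_eq_mul]
  have h1 := mul_nonneg ha (hq v w)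
  have h2 := mul_nonneg hb (hq' v w)
  have h3 : b = 1 - a := by linarith
  subst h3
  linarith

/-- Since `S` preserves `J` and `J` is orthogonal, the form at `(v, w)` is the square `|Sv + JSw|²`.
-/
theorem transpose_mul_self_mem_covarianceMatrices {S : PhaseMatrix n}
    (hS : S ∈ Matrix.symplecticGroup (Fin n) ℝ) : Sᵀ * S ∈ covarianceMatrices n := by
  rw [mem_symplecticGroup_iff_sympForm] at hS
  refine mem_covarianceMatrices_iff.2 ⟨isSymm_transpose_mul S, fun v w => ?_⟩
  set x := S *ᵥ v with hx
  set y := sympForm n *ᵥ (S *ᵥ w) with hy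
  have h1 : v ⬝ᵥ sympForm n *ᵥ w = x ⬝ᵥ y := by
    rw [hx, hy, ← hS, ← Matrix.mulVec_mulVec, ← Matrix.mulVec_mulVec, Matrix.dotProduct_mulVec,
      Matrix.vecMul_transpose, hS]
  have h2 : y ⬝ᵥ y = (S *ᵥ w) ⬝ᵥ (S *ᵥ w) := by
    rw [hy, ← dotProduct_transpose_mul_mulVec, sympForm_transpose, Matrix.neg_mul,
      sympForm_mul_self]
    simp
  rw [dotProduct_transpose_mul_mulVec, dotProduct_transpose_mul_mulVec, h1, ← h2]
  have h3 : 0 ≤ (x + y) ⬝ᵥ (x + y) := by simpa using dotProduct_star_self_nonneg (x + y)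
  simp only [add_dotProduct, dotProduct_add, dotProduct_comm y x] at h3
  linarith

theorem mem_symplecticGroup_isUnit {S : PhaseMatrix n}
    (hS : S ∈ Matrix.symplecticGroup (Fin n) ℝ) : IsUnit S :=
  (Matrix.isUnit_iff_isUnit_det S).2 (SymplecticGroup.symplectic_det hS)

/-! ### Symplectic matrices below a covariance matrix -/

section Existence

open scoped MatrixOrder

/-- The positive square root of a positive semidefinite symplectic matrix is symplectic. -/
theorem exists_symplectic_transpose_mul_self_eq {M : PhaseMatrix n} (hM : M.PosSemidef)
    (h : M * sympForm n * M = sympForm n) :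
    ∃ S ∈ Matrix.symplecticGroup (Fin n) ℝ, Sᵀ * S = M := by
  set J := sympForm n with hJ
  have hJJ : J * J = -1 := sympForm_mul_self n
  have hJT : Jᵀ = -J := sympForm_transpose n
  set S := CFC.sqrt M
  have hS : S.PosSemidef := Matrix.nonneg_iff_posSemidef.1 (CFC.sqrt_nonneg M)
  have hSS : S * S = M := CFC.sqrt_mul_sqrt_self M hM.nonneg
  have hST : Sᵀ = S := ((posSemidef_real_iff S).1 hS).1
  have hMinv : M * (Jᵀ * M * J) = 1 := by
    rw [hJT, ← mul_assoc, ← mul_assoc, mul_neg, neg_mul, h, neg_mul, hJJ, neg_neg]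
  have hMu : IsUnit M := .of_mul_eq_one _ hMinv
  have hSu : IsUnit S := by
    rw [Matrix.isUnit_iff_isUnit_det] at hMu ⊢
    rw [← hSS, Matrix.det_mul] at hMu
    exact isUnit_of_mul_isUnit_left hMu
  have hSdet := (Matrix.isUnit_iff_isUnit_det S).1 hSu
  have hQ : (Jᵀ * S * J).PosSemidef := by
    simpa [Matrix.conjTranspose_eq_transpose_of_trivial] using hS.conjTranspose_mul_mul_same J
  have hQQ : (Jᵀ * S * J) * (Jᵀ * S * J) = S⁻¹ * S⁻¹ := by
    rw [← Matrix.mul_inv_rev, hSS, Matrix.inv_eq_right_inv hMinv, ← hSS, hJT]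
    calc -J * S * J * (-J * S * J) = -(-J * S * (J * J) * S * J) := by noncomm_ring
      _ = _ := by rw [hJJ]; noncomm_ring
  -- Both sides are positive semidefinite square roots of `M⁻¹ = JᵀMJ`, hence equal.
  have hQS : Jᵀ * S * J = S⁻¹ :=
    (CFC.mul_self_eq_mul_self_iff _ _ hQ.nonneg hS.inv.nonneg).1 hQQ
  refine ⟨S, (mem_symplecticGroup_iff_sympForm n S).2 ?_, by rw [hST, hSS]⟩
  rw [hST, ← hJ]
  calc S * J * S = -(J * J) * (S * J * S) := by rw [hJJ]; simp
    _ = J * (Jᵀ * S * J) * S := by rw [hJT]; noncomm_ring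
    _ = J := by rw [hQS, mul_assoc, Matrix.nonsing_inv_mul _ hSdet, mul_one]

/-- Write `Γ = RᵀR`. In the coordinates of `R` the form `J` becomes the antisymmetric `B = R⁻ᵀJR⁻¹`,
and `Γ ≥ iJ` yields `BᵀB ≤ 1`. Then `P = |B|` satisfies `P ≤ 1` and commutes with `B`, so `M = RᵀPR`
lies below `Γ` and satisfies `MJM = J`. -/
theorem exists_symplectic_le {Γ : PhaseMatrix n} (h : Γ ∈ covarianceMatrices n) :
    ∃ S ∈ Matrix.symplecticGroup (Fin n) ℝ, (Γ - Sᵀ * S).PosSemidef := by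
  have hq := (mem_covarianceMatrices_iff.1 h).2
  have hΓ := posDef_of_mem_covarianceMatrices h
  set J := sympForm n with hJ
  have hJJ : J * J = -1 := sympForm_mul_self n
  have hJT : Jᵀ = -J := sympForm_transpose n
  obtain ⟨R, hR⟩ := CStarAlgebra.nonneg_iff_eq_star_mul_self.mp hΓ.posSemidef.nonneg
  rw [Matrix.star_eq_conjTranspose, Matrix.conjTranspose_eq_transpose_of_trivial] at hR
  have hRdet : IsUnit R.det := by
    have := (Matrix.isUnit_iff_isUnit_det Γ).1 hΓ.isUnit
    rw [hR, Matrix.det_mul] at this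
    exact isUnit_of_mul_isUnit_right this
  have hRi : R * R⁻¹ = 1 := Matrix.mul_nonsing_inv _ hRdet
  have hiR : R⁻¹ * R = 1 := Matrix.nonsing_inv_mul _ hRdet
  have hRiT : R⁻¹ᵀ * Rᵀ = 1 := by rw [← Matrix.transpose_mul, hRi, Matrix.transpose_one]
  have hiRT : Rᵀ * R⁻¹ᵀ = 1 := by rw [← Matrix.transpose_mul, hiR, Matrix.transpose_one]
  set B := R⁻¹ᵀ * J * R⁻¹ with hB
  set K := R * J * Rᵀ with hK
  have hBT : Bᵀ = -B := by
    simp [hB, Matrix.transpose_mul, hJT, mul_assoc]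
  have hKB : K * B = -1 := by
    calc K * B = R * J * (Rᵀ * R⁻¹ᵀ) * J * R⁻¹ := by rw [hK, hB]; noncomm_ring
      _ = R * (J * J) * R⁻¹ := by rw [hiRT]; noncomm_ring
      _ = _ := by rw [hJJ]; simp [hRi]
  have hBK : B * K = -1 := by
    have : -K * B = 1 := by rw [neg_mul, hKB, neg_neg]
    have := mul_eq_one_comm.1 this
    rw [← neg_neg (B * K), ← mul_neg, this]
  have hBB : (1 - Bᵀ * B).PosSemidef := by
    refine (posSemidef_real_iff _).2
      ⟨Matrix.isSymm_one.sub (isSymm_transpose_mul B), fun y => ?_⟩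
    -- At this pair the form equals `|y|² - |By|²`.
    have := hq (-(R⁻¹ *ᵥ (B *ᵥ y))) (R⁻¹ *ᵥ y)
    have hx : ∀ x, (R⁻¹ *ᵥ x) ⬝ᵥ Γ *ᵥ (R⁻¹ *ᵥ x) = x ⬝ᵥ x := fun x => by
      rw [hR, dotProduct_transpose_mul_mulVec, Matrix.mulVec_mulVec, hRi, Matrix.one_mulVec]
    have hxy : ∀ x y, (R⁻¹ *ᵥ x) ⬝ᵥ J *ᵥ (R⁻¹ *ᵥ y) = x ⬝ᵥ B *ᵥ y := fun x y => by
      rw [hB, ← Matrix.mulVec_mulVec, ← Matrix.mulVec_mulVec, Matrix.dotProduct_mulVec x,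
        Matrix.vecMul_transpose]
    rw [Matrix.mulVec_neg, neg_dotProduct, dotProduct_neg, neg_dotProduct, hxy, hx, hx] at this
    rw [Matrix.sub_mulVec, dotProduct_sub, dotProduct_transpose_mul_mulVec, Matrix.one_mulVec]
    linarith
  set P := CFC.abs B
  have hP : P.PosSemidef := Matrix.nonneg_iff_posSemidef.1 (CFC.abs_nonneg B)
  have hPP : P * P = Bᵀ * B := by
    simpa [Matrix.star_eq_conjTranspose, Matrix.conjTranspose_eq_transpose_of_trivial]
      using CFC.abs_mul_abs B
  have hPT : Pᵀ = P := ((posSemidef_real_iff P).1 hP).1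
  have hcomm : P * B = B * P := by
    refine (Commute.refl B).cfcAbs_left ?_
    rw [Matrix.star_eq_conjTranspose, Matrix.conjTranspose_eq_transpose_of_trivial, hBT]
    exact (Commute.refl B).neg_right
  have hP1 : (1 - P).PosSemidef := by
    have h1 : (1 - P) = (1 / 2 : ℝ) • ((1 - Bᵀ * B) + (1 - P)ᵀ * (1 - P)) := by
      have : (1 - Bᵀ * B) + (1 - P)ᵀ * (1 - P) = (2 : ℝ) • (1 - P) := by
        rw [← hPP, Matrix.transpose_sub, Matrix.transpose_one, hPT, two_smul]
        noncomm_ring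
      rw [this, smul_smul]
      norm_num
    rw [h1]
    refine (hBB.add ?_).smul (by norm_num)
    rw [← Matrix.conjTranspose_eq_transpose_of_trivial]
    exact Matrix.posSemidef_conjTranspose_mul_self (1 - P)
  -- As `K = -B⁻¹` and `P` commutes with `B`, the product is `-P²B⁻¹ = -BᵀBB⁻¹ = B`.
  have hPKP : P * K * P = B := by
    calc P * K * P = -(K * B) * (P * K * P) := by rw [hKB]; simp
      _ = -K * (B * P) * (K * P) := by noncomm_ring
      _ = -K * P * (B * K) * P := by rw [← hcomm]; noncomm_ring
      _ = K * (P * P) := by rw [hBK]; noncomm_ring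
      _ = -(K * B) * B := by rw [hPP, hBT]; noncomm_ring
      _ = B := by rw [hKB]; simp
  have hM : (Rᵀ * P * R).PosSemidef := by
    simpa [Matrix.conjTranspose_eq_transpose_of_trivial] using hP.conjTranspose_mul_mul_same R
  obtain ⟨S, hS, hSM⟩ := exists_symplectic_transpose_mul_self_eq hM (by
    calc Rᵀ * P * R * J * (Rᵀ * P * R) = Rᵀ * (P * K * P) * R := by rw [hK]; noncomm_ring
      _ = (Rᵀ * R⁻¹ᵀ) * J * (R⁻¹ * R) := by rw [hPKP, hB]; noncomm_ring
      _ = J := by rw [hiRT, hiR]; simp)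
  refine ⟨S, hS, ?_⟩
  have : Γ - Sᵀ * S = Rᵀ * (1 - P) * R := by rw [hSM, hR]; noncomm_ring
  rw [this]
  simpa [Matrix.conjTranspose_eq_transpose_of_trivial] using hP1.conjTranspose_mul_mul_same R

end Existence

/-! ### Monotonicity and lower semicontinuity of `F` -/

theorem norm_sq_toEuclideanLin {m : Type*} [Fintype m] [DecidableEq m] (A : Matrix m m ℝ)
    (v : EuclideanSpace ℝ m) :
    ‖Matrix.toEuclideanLin A v‖ ^ 2 = v.ofLp ⬝ᵥ (Aᵀ * A) *ᵥ v.ofLp := by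
  rw [EuclideanSpace.real_norm_sq_eq, dotProduct_transpose_mul_mulVec]
  simp [dotProduct, sq]

theorem singularValues_pos {A : PhaseMatrix n} (hA : IsUnit A) {i : ℕ} (hi : i < n) :
    0 < (Matrix.toEuclideanLin A).singularValues i := by
  refine LinearMap.injective_iff_forall_lt_finrank_singularValues_pos _ |>.1 ?_ i ?_
  · intro x y hxy
    have := Matrix.mulVec_injective_of_isUnit hA (congrArg WithLp.ofLp hxy)
    exact WithLp.ofLp_injective 2 this
  · simp
    omega

theorem squeezingF_le_add {A B : PhaseMatrix n} (hA : IsUnit A) {c : ℝ} (hc : 0 < c)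
    (h : (c • (Bᵀ * B) - Aᵀ * A).PosSemidef) :
    squeezingF A ≤ squeezingF B + n * (Real.log c / 2) := by
  have hcomp := singularValues_sq_le_of_norm_sq_le (Matrix.toEuclideanLin A)
    (Matrix.toEuclideanLin B) hc.le (fun v => by
      have := ((posSemidef_real_iff _).1 h).2 v.ofLp
      rw [norm_sq_toEuclideanLin, norm_sq_toEuclideanLin]
      rw [Matrix.sub_mulVec, dotProduct_sub, Matrix.smul_mulVec, dotProduct_smul,
        smul_eq_mul] at this
      linarith)
  have hcard : (n : ℝ) * (Real.log c / 2) = ∑ _i ∈ Finset.range n, Real.log c / 2 := by simp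
  rw [squeezingF, squeezingF, hcard, ← Finset.sum_add_distrib]
  refine Finset.sum_le_sum fun i hi => ?_
  have hpos := singularValues_pos hA (Finset.mem_range.1 hi)
  -- `B` may be singular, but the comparison with `A` excludes the default value `log 0 = 0`.
  have hB : (Matrix.toEuclideanLin B).singularValues i ≠ 0 := by
    intro h0
    have := hcomp i
    rw [h0] at this
    have := pow_pos hpos 2
    linarith
  have hlog := Real.log_le_log (pow_pos hpos 2) (hcomp i)
  rw [Real.log_mul hc.ne' (pow_ne_zero 2 hB), Real.log_pow, Real.log_pow] at hlog
  push_cast at hlog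
  linarith

theorem posDef_transpose_mul_self {A : PhaseMatrix n} (hA : IsUnit A) : (Aᵀ * A).PosDef := by
  rw [← Matrix.conjTranspose_eq_transpose_of_trivial]
  exact Matrix.PosDef.conjTranspose_mul_self A (Matrix.mulVec_injective_of_isUnit hA)

/-- For every error `δ > 0` there is a Loewner factor `c > 1` that changes `F` by less than `δ`. -/
theorem exists_one_lt_mul_log_lt (n : ℕ) {δ : ℝ} (hδ : 0 < δ) :
    ∃ c : ℝ, 1 < c ∧ n * (Real.log c / 2) < δ := by
  refine ⟨Real.exp (δ / (n + 1)), Real.one_lt_exp_iff.2 (by positivity), ?_⟩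
  rw [Real.log_exp]
  have hn : (0 : ℝ) ≤ n := n.cast_nonneg
  rw [div_div, ← mul_div_assoc, div_lt_iff₀ (by positivity)]
  nlinarith

/-- For `c > 1`, `c AᵀA - SᵀS` tends to the positive definite `(c - 1) SᵀS` as `A → S`, so `SᵀS ≤ c
AᵀA` nearby. -/
theorem lowerSemicontinuousAt_squeezingF {S : PhaseMatrix n} (hS : IsUnit S) :
    LowerSemicontinuousAt squeezingF S := by
  intro y hy
  obtain ⟨c, hc, hcn⟩ := exists_one_lt_mul_log_lt n (sub_pos.2 hy)
  have hpd : ((c - 1) • (Sᵀ * S)).PosDef := (posDef_transpose_mul_self hS).smul (sub_pos.2 hc)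
  have hcont : Filter.Tendsto (fun A : PhaseMatrix n => c • (Aᵀ * A) - Sᵀ * S) (𝓝 S)
      (𝓝 ((c - 1) • (Sᵀ * S))) := by
    have : Continuous fun A : PhaseMatrix n => c • (Aᵀ * A) - Sᵀ * S := by fun_prop
    convert this.tendsto S using 2
    rw [sub_smul, one_smul]
  filter_upwards [hcont.eventually (eventually_posSemidef_of_posDef hpd)] with A hA
  have := squeezingF_le_add hS (zero_lt_one.trans hc)
    (hA (((isSymm_transpose_mul A).smul c).sub (isSymm_transpose_mul S)))
  linarith

theorem lowerSemicontinuousOn_squeezingF :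
    LowerSemicontinuousOn (squeezingF (n := n)) (Matrix.symplecticGroup (Fin n) ℝ) :=
  fun _ hS => (lowerSemicontinuousAt_squeezingF
    (mem_symplecticGroup_isUnit hS)).lowerSemicontinuousWithinAt _

/-! ### Compactness of the feasible set and attainment of the infimum -/

theorem isClosed_symplecticGroup :
    IsClosed (Matrix.symplecticGroup (Fin n) ℝ : Set (PhaseMatrix n)) := by
  have : (Matrix.symplecticGroup (Fin n) ℝ : Set (PhaseMatrix n)) =
      {S | Sᵀ * sympForm n * S = sympForm n} :=
    Set.ext fun S => mem_symplecticGroup_iff_sympForm n S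
  rw [this]
  exact isClosed_eq (by fun_prop) continuous_const

theorem isCompact_symplectic_bounded (C : ℝ) :
    IsCompact {S : PhaseMatrix n | S ∈ Matrix.symplecticGroup (Fin n) ℝ ∧ ∀ i j, |S i j| ≤ C} := by
  have hbox : IsCompact {S : PhaseMatrix n | ∀ i j, |S i j| ≤ C} := by
    have := isCompact_univ_pi (X := fun _ : Fin n ⊕ Fin n => Fin n ⊕ Fin n → ℝ) fun _ =>
      isCompact_univ_pi fun _ => isCompact_Icc (a := -C) (b := C)
    have heq : {S : PhaseMatrix n | ∀ i j, |S i j| ≤ C} = Set.univ.pi fun _ : Fin n ⊕ Fin n =>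
        Set.univ.pi fun _ : Fin n ⊕ Fin n => Set.Icc (-C) C :=
      Set.ext fun S => by
        simp only [abs_le, Set.mem_ofPred_eq]
        exact ⟨fun h i _ j _ => h i j, fun h i j => h i trivial j trivial⟩
    rw [heq]
    exact this
  exact hbox.inter_left isClosed_symplecticGroup

/-- The squared norm of column `j` of `S` is at most `Γ j j`; `C + 1` replaces `√C`. Only the
diagonal enters, so the bound is uniform for `Γ` in a bounded set. -/
theorem abs_apply_le_of_transpose_mul_self_le {S Γ : PhaseMatrix n} (h : (Γ - Sᵀ * S).PosSemidef)
    {C : ℝ} (hC : ∀ j, Γ j j ≤ C) (i j : Fin n ⊕ Fin n) : |S i j| ≤ C + 1 := by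
  have h1 : 0 ≤ Γ j j - ∑ k, S k j * S k j := by
    simpa [Matrix.mul_apply] using h.diag_nonneg (i := j)
  have h2 : S i j * S i j ≤ ∑ k, S k j * S k j :=
    Finset.single_le_sum (f := fun k => S k j * S k j) (fun k _ => mul_self_nonneg _)
      (Finset.mem_univ i)
  have h3 : |S i j| * |S i j| ≤ C := by
    rw [abs_mul_abs_self]
    linarith [hC j]
  nlinarith [sq_nonneg (|S i j| - 1)]

theorem isCompact_symplectic_le (Γ : PhaseMatrix n) :
    IsCompact {S : PhaseMatrix n | S ∈ Matrix.symplecticGroup (Fin n) ℝ ∧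
      (Γ - Sᵀ * S).PosSemidef} := by
  obtain ⟨C, hC⟩ := (Set.finite_range fun j => Γ j j).bddAbove
  have hcl : IsClosed {S : PhaseMatrix n | (Γ - Sᵀ * S).PosSemidef} :=
    isClosed_posSemidef.preimage (f := fun S : PhaseMatrix n => Γ - Sᵀ * S) (by fun_prop)
  refine (isCompact_symplectic_bounded (C + 1)).of_isClosed_subset
    (isClosed_symplecticGroup.inter hcl) fun S hS => ⟨hS.1, ?_⟩
  exact abs_apply_le_of_transpose_mul_self_le hS.2 fun j => hC ⟨j, rfl⟩

/-- The infimum defining `G` is attained. -/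
theorem exists_isLeast_squeezingCosts {Γ : PhaseMatrix n} (h : Γ ∈ covarianceMatrices n) :
    ∃ S ∈ Matrix.symplecticGroup (Fin n) ℝ, (Γ - Sᵀ * S).PosSemidef ∧
      IsLeast (squeezingCosts Γ) (squeezingF S) := by
  obtain ⟨S₀, hS₀⟩ := exists_symplectic_le h
  obtain ⟨S, hS, hmin⟩ := LowerSemicontinuousOn.exists_isMinOn ⟨S₀, hS₀⟩ (isCompact_symplectic_le Γ)
    (lowerSemicontinuousOn_squeezingF.mono fun S hS => hS.1)
  refine ⟨S, hS.1, hS.2, ⟨S, hS.1, hS.2, rfl⟩, ?_⟩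
  rintro _ ⟨T, hT, hTΓ, rfl⟩
  exact hmin ⟨hT, hTΓ⟩

theorem exists_squeezingG_eq {Γ : PhaseMatrix n} (h : Γ ∈ covarianceMatrices n) :
    ∃ S ∈ Matrix.symplecticGroup (Fin n) ℝ, (Γ - Sᵀ * S).PosSemidef ∧
      squeezingG Γ = squeezingF S := by
  obtain ⟨S, hS, hSΓ, hl⟩ := exists_isLeast_squeezingCosts h
  exact ⟨S, hS, hSΓ, hl.csInf_eq⟩

theorem squeezingG_le {Γ S : PhaseMatrix n} (h : Γ ∈ covarianceMatrices n)
    (hS : S ∈ Matrix.symplecticGroup (Fin n) ℝ) (hSΓ : (Γ - Sᵀ * S).PosSemidef) :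
    squeezingG Γ ≤ squeezingF S := by
  obtain ⟨T, -, -, hl⟩ := exists_isLeast_squeezingCosts h
  exact csInf_le ⟨_, hl.2⟩ ⟨S, hS, hSΓ, rfl⟩

/-! ### Semicontinuity of `G` -/

/-- Along a sequence `u k → Γ` with `G(u k) ≤ y < G(Γ)`, minimizers eventually stay in one compact
set. A limit point `S` is feasible for `Γ`, so `F(S) > y`, against lower semicontinuity of `F` at
`S`. -/
theorem lowerSemicontinuousOn_squeezingG :
    LowerSemicontinuousOn (fun Γ : PhaseMatrix n => squeezingG Γ) (covarianceMatrices n) := by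
  intro Γ hΓ y hy
  by_contra hcon
  have : FirstCountableTopology (PhaseMatrix n) :=
    inferInstanceAs (FirstCountableTopology (Fin n ⊕ Fin n → Fin n ⊕ Fin n → ℝ))
  obtain ⟨u, hu, hfreq⟩ := Filter.exists_seq_forall_of_frequently
    ((Filter.not_eventually.1 hcon).and_eventually self_mem_nhdsWithin)
  have hu' : Filter.Tendsto u Filter.atTop (𝓝 Γ) := hu.mono_right nhdsWithin_le_nhds
  choose T hT hTu hTG using fun k => exists_squeezingG_eq (hfreq k).2
  obtain ⟨C, hC⟩ := (Set.finite_range fun j => Γ j j).bddAbove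
  have hbd : ∀ᶠ k in Filter.atTop, ∀ j, u k j j ≤ C + 1 := by
    refine Filter.eventually_all.2 fun j => ?_
    have hj : Filter.Tendsto (fun k => u k j j) Filter.atTop (𝓝 (Γ j j)) :=
      ((continuous_id.matrix_elem j j).tendsto Γ).comp hu'
    exact (hj.eventually (gt_mem_nhds (lt_of_le_of_lt (hC ⟨j, rfl⟩) (lt_add_one C)))).mono
      fun k hk => hk.le
  obtain ⟨S, hS, φ, hφ, hlim⟩ := (isCompact_symplectic_bounded (n := n) (C + 1 + 1)).tendsto_subseq'
    (hbd.mono fun k hk => ⟨hT k, abs_apply_le_of_transpose_mul_self_le (hTu k) hk⟩).frequently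
  have hSΓ : (Γ - Sᵀ * S).PosSemidef := by
    have hc : Continuous fun p : PhaseMatrix n × PhaseMatrix n => p.1 - p.2ᵀ * p.2 := by fun_prop
    have := (hc.tendsto (Γ, S)).comp ((hu'.comp hφ.tendsto_atTop).prodMk_nhds hlim)
    exact isClosed_posSemidef.mem_of_tendsto this (Filter.Eventually.of_forall fun k => hTu (φ k))
  have hlt : y < squeezingF S := lt_of_lt_of_le hy (squeezingG_le hΓ hS.1 hSΓ)
  obtain ⟨k, hk⟩ := (hlim.eventually
    (lowerSemicontinuousAt_squeezingF (mem_symplecticGroup_isUnit hS.1) y hlt)).exists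
  exact (hfreq (φ k)).1 (by simpa only [hTG, Function.comp_apply] using hk)

theorem squeezingG_anti {Γ Γ' : PhaseMatrix n} (h : Γ ∈ covarianceMatrices n)
    (hle : (Γ' - Γ).PosSemidef) : squeezingG Γ' ≤ squeezingG Γ := by
  obtain ⟨S, hS, hSΓ, hG⟩ := exists_squeezingG_eq h
  have hΓ' : Γ' ∈ covarianceMatrices n := by
    simpa using add_mem_covarianceMatrices h hle
  rw [hG]
  exact squeezingG_le hΓ' hS (by simpa using hle.add hSΓ)

theorem tendsto_squeezingG_add_smul_one {Γ : PhaseMatrix n} (h : Γ ∈ covarianceMatrices n) :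
    Filter.Tendsto (fun ε : ℝ => squeezingG (Γ + ε • (1 : PhaseMatrix n)))
      (𝓝[>] 0) (𝓝 (squeezingG Γ)) := by
  have hpos : ∀ ε : ℝ, 0 < ε → (ε • (1 : PhaseMatrix n)).PosSemidef := fun ε hε =>
    Matrix.PosSemidef.one.smul hε.le
  have hlim : Filter.Tendsto (fun ε : ℝ => Γ + ε • (1 : PhaseMatrix n)) (𝓝[>] 0)
      (𝓝[covarianceMatrices n] Γ) := by
    refine tendsto_nhdsWithin_iff.2 ⟨?_, ?_⟩
    · have : Continuous fun ε : ℝ => Γ + ε • (1 : PhaseMatrix n) := by fun_prop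
      simpa using (this.tendsto 0).mono_left nhdsWithin_le_nhds
    · filter_upwards [self_mem_nhdsWithin] with ε hε
      exact add_mem_covarianceMatrices h (hpos ε hε)
  refine tendsto_order.2 ⟨fun y hy => ?_, fun y hy => ?_⟩
  · exact hlim.eventually (lowerSemicontinuousOn_squeezingG Γ h y hy)
  · filter_upwards [self_mem_nhdsWithin] with ε hε
    exact (squeezingG_anti h (by simpa using hpos ε hε)).trans_lt hy

theorem exists_sub_smul_one_mem_of_mem_covarianceInterior {Γ : SymmPhaseMatrix n}
    (h : Γ ∈ covarianceInterior n) :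
    ∃ δ : ℝ, 0 < δ ∧ (Γ : PhaseMatrix n) - δ • (1 : PhaseMatrix n) ∈ covarianceMatrices n := by
  let γ : ℝ → SymmPhaseMatrix n := fun δ =>
    ⟨(Γ : PhaseMatrix n) - δ • (1 : PhaseMatrix n), Γ.2.sub (Matrix.isSymm_one.smul δ)⟩
  have hγ : Continuous γ := Continuous.subtype_mk (by fun_prop) _
  have h0 : γ 0 = Γ := Subtype.ext (by simp [γ])
  have hev : ∀ᶠ δ in 𝓝 (0 : ℝ), γ δ ∈ {Γ : SymmPhaseMatrix n | (Γ : PhaseMatrix n) ∈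
      covarianceMatrices n} :=
    hγ.continuousAt.eventually (by rw [h0]; exact mem_interior_iff_mem_nhds.1 h)
  obtain ⟨δ, hδ, hδ0⟩ := ((hev.filter_mono nhdsWithin_le_nhds).and
    (self_mem_nhdsWithin : Set.Ioi (0 : ℝ) ∈ 𝓝[>] 0)).exists
  exact ⟨δ, hδ0, hδ⟩

theorem mem_of_mem_covarianceInterior {Γ : SymmPhaseMatrix n}
    (h : Γ ∈ covarianceInterior n) : (Γ : PhaseMatrix n) ∈ covarianceMatrices n :=
  (interior_subset h : Γ ∈ {Γ : SymmPhaseMatrix n | (Γ : PhaseMatrix n) ∈ covarianceMatrices n})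

theorem upperSemicontinuousOn_squeezingG_interior :
    UpperSemicontinuousOn (fun Γ : SymmPhaseMatrix n => squeezingG (Γ : PhaseMatrix n))
      (covarianceInterior n) := by
  intro Γ hΓ y hy
  have hΓc : (Γ : PhaseMatrix n) ∈ covarianceMatrices n := mem_of_mem_covarianceInterior hΓ
  obtain ⟨δ, hδ, hδΓ⟩ := exists_sub_smul_one_mem_of_mem_covarianceInterior hΓ
  obtain ⟨S, hS, hSΓ, hG⟩ := exists_squeezingG_eq hΓc
  simp only [hG] at hy
  obtain ⟨c, hc, hcn⟩ := exists_one_lt_mul_log_lt n (sub_pos.2 hy)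
  set M := Sᵀ * S with hM
  set N := (Γ : PhaseMatrix n) - δ • (1 : PhaseMatrix n) with hN
  have hNs : N.IsSymm := Γ.2.sub (Matrix.isSymm_one.smul δ)
  have hpd : ((c - 1) • M).PosDef :=
    (posDef_transpose_mul_self (mem_symplecticGroup_isUnit hS)).smul (sub_pos.2 hc)
  have hcont : Filter.Tendsto (fun t : ℝ => c • M - ((1 - t) • M + t • N)) (𝓝 0)
      (𝓝 ((c - 1) • M)) := by
    have : Continuous fun t : ℝ => c • M - ((1 - t) • M + t • N) := by fun_prop
    convert this.tendsto 0 using 2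
    simp [sub_smul]
  obtain ⟨t, ht, ht0, ht1⟩ := (((hcont.eventually
    (eventually_posSemidef_of_posDef hpd)).filter_mono nhdsWithin_le_nhds).and
    (Ioo_mem_nhdsGT (zero_lt_one' ℝ))).exists
  have hMs : M.IsSymm := isSymm_transpose_mul S
  have hle := ht ((hMs.smul c).sub ((hMs.smul (1 - t)).add (hNs.smul t)))
  -- The mixture `(1 - t) M + t N` lies below `Γ - tδ 1`, which leaves room `tδ` for perturbing `Γ`;
  -- small `t` keeps it below `c M`, which controls `F(T)`.
  obtain ⟨T, hT, hTle⟩ := exists_symplectic_le (convex_covarianceMatrices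
    (transpose_mul_self_mem_covarianceMatrices hS) hδΓ (sub_nonneg.2 ht1.le) ht0.le (by ring))
  have hF := squeezingF_le_add (B := S) (mem_symplecticGroup_isUnit hT) (zero_lt_one.trans hc)
    (by convert hle.add hTle using 1; rw [hM]; abel)
  have hpert : Filter.Tendsto (fun Γ' : SymmPhaseMatrix n =>
      (Γ' : PhaseMatrix n) - (Γ : PhaseMatrix n) + (t * δ) • (1 : PhaseMatrix n))
      (𝓝 Γ) (𝓝 ((t * δ) • (1 : PhaseMatrix n))) := by
    have : Continuous fun Γ' : SymmPhaseMatrix n =>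
      (Γ' : PhaseMatrix n) - (Γ : PhaseMatrix n) + (t * δ) • (1 : PhaseMatrix n) := by fun_prop
    simpa using this.tendsto Γ
  have hev := hpert.eventually (eventually_posSemidef_of_posDef
    (Matrix.PosDef.one.smul (mul_pos ht0 hδ)))
  filter_upwards [hev.filter_mono nhdsWithin_le_nhds, self_mem_nhdsWithin] with Γ' hΓ' hΓ'i
  have hΓ'p := hΓ' ((Γ'.2.sub Γ.2).add (Matrix.isSymm_one.smul _))
  refine (squeezingG_le (mem_of_mem_covarianceInterior hΓ'i) hT ?_).trans_lt
    (by linarith : squeezingF T < y)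
  -- The three positive semidefinite terms telescope to `Γ' - TᵀT`.
  have hsum := (hΓ'p.add (hSΓ.smul (sub_nonneg.2 ht1.le))).add hTle
  convert hsum using 1
  rw [hN]
  module

theorem continuousOn_squeezingG_interior :
    ContinuousOn (fun Γ : SymmPhaseMatrix n => squeezingG (Γ : PhaseMatrix n))
      (covarianceInterior n) := by
  refine continuousOn_iff_lower_upperSemicontinuousOn.2
    ⟨fun Γ hΓ y hy => ?_, upperSemicontinuousOn_squeezingG_interior⟩
  have hlim : Filter.Tendsto (fun Γ : SymmPhaseMatrix n => (Γ : PhaseMatrix n))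
      (𝓝[covarianceInterior n] Γ) (𝓝[covarianceMatrices n] (Γ : PhaseMatrix n)) :=
    tendsto_nhdsWithin_iff.2 ⟨continuous_subtype_val.continuousAt.mono_left nhdsWithin_le_nhds,
        Filter.eventually_of_mem self_mem_nhdsWithin fun _ h => mem_of_mem_covarianceInterior h⟩
  exact hlim.eventually (lowerSemicontinuousOn_squeezingG _
    (mem_of_mem_covarianceInterior hΓ) y hy)

end Squeezing

theorem mainTheorem6 (n : ℕ) :
    (∀ Γ ∈ covarianceMatrices n,
      (squeezingCosts Γ).Nonempty ∧ BddBelow (squeezingCosts Γ)) ∧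
    LowerSemicontinuousOn (fun Γ : PhaseMatrix n => squeezingG Γ) (covarianceMatrices n) ∧
    ContinuousOn (fun Γ : SymmPhaseMatrix n => squeezingG (Γ : PhaseMatrix n))
      (covarianceInterior n) ∧
    ∀ Γ ∈ covarianceMatrices n,
      Filter.Tendsto (fun ε : ℝ => squeezingG (Γ + ε • (1 : PhaseMatrix n)))
        (𝓝[>] 0) (𝓝 (squeezingG Γ)) := by
  refine ⟨fun Γ hΓ => ?_, lowerSemicontinuousOn_squeezingG, continuousOn_squeezingG_interior,
    fun Γ hΓ => tendsto_squeezingG_add_smul_one hΓ⟩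
  obtain ⟨S, -, -, hl⟩ := exists_isLeast_squeezingCosts hΓ
  exact ⟨⟨_, hl.1⟩, ⟨_, hl.2⟩⟩
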